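/- Let $p>0$ be a real number and let $m\ge 3$ be an integer. Let $\lambda_1,\dots,\lambda_m$ be positive real numbers, all different from $1$, such that the set $\{\lambda_1,\dots,\lambda_m\}$ is not of the form $\{\lambda\}$ or $\{\lambda,\lambda^{-1}\}$ with any $\lambda>0$. Let $C^\infty(S^1)$ be the Fréchet space of all $C^\infty$ functions $\mathbb{R}\to\mathbb{R}$ of period $p$, with the topology of uniform convergence of the derivatives of every order. Then there exists a nonempty infinite-dimensional $C^\infty$ submanifold $M$ of $C^\infty(S^1)$ such that every $f\in M$ is nonconstant and has the following property: for some nonzero traceless diagonal real $m\times m$ matrix $A$ and some $C^\infty$ curve $t\mapsto B(t)$ of diagonal real $m\times m$ matrices, periodic of period $p$, $$\dot B+B^2=f\,\mathrm{Id}+A\qquad\text{and}\qquad \mathrm{diag}(\log\lambda_1,\dots,\log\lambda_m)=-\int_0^pB(t)\,dt .$$ Here an infinite-dimensional $C^\infty$ submanifold of a topological vector space $E$ is a set $M\subseteq E$ for which there is an infinite-dimensional linear subspace $F\subseteq E$, admitting a continuous linear projection $E\to F$, such that every point of $M$ lies in the domain of a $C^\infty$ diffeomorphism $\varphi:W\to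 W'$ between open subsets of $E$ with $\varphi(W\cap M)=W'\cap F$; a map is $C^\infty$ if it is continuous and has continuous iterated directional derivatives of all orders. -/

import Mathlib

open Set Filter Topology
open scoped ContDiff

noncomputable section

/-! ### The Fréchet space of smooth `p`-periodic functions -/

/-- The `C^∞` functions `ℝ → ℝ` of period `p`, as a linear subspace of `ℝ → ℝ`. -/
def smoothPeriodicSubmodule (p : ℝ) : Submodule ℝ (ℝ → ℝ) where
  carrier := {f | ContDiff ℝ ∞ f ∧ Function.Periodic f p}
  add_mem' hf hg := ⟨hf.1.add hg.1, hf.2.add hg.2⟩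
  zero_mem' := ⟨contDiff_const, fun _ => rfl⟩
  smul_mem' c _ hf := ⟨contDiff_const.smul hf.1, hf.2.smul c⟩

/-- The vector space `C^∞(S¹)` of `C^∞` functions `ℝ → ℝ` of period `p`. It is a type of its own,
so that it carries the topology below and not the topology of pointwise convergence. -/
def SmoothPeriodic (p : ℝ) : Type := smoothPeriodicSubmodule p

namespace SmoothPeriodic

variable {p : ℝ}

instance : AddCommGroup (SmoothPeriodic p) :=
  inferInstanceAs (AddCommGroup (smoothPeriodicSubmodule p))

instance : Module ℝ (SmoothPeriodic p) :=
  inferInstanceAs (Module ℝ (smoothPeriodicSubmodule p))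

instance : CoeFun (SmoothPeriodic p) (fun _ => ℝ → ℝ) := ⟨fun f => f.1⟩

theorem contDiff (f : SmoothPeriodic p) : ContDiff ℝ ∞ (f : ℝ → ℝ) := f.2.1

theorem periodic (f : SmoothPeriodic p) : Function.Periodic (f : ℝ → ℝ) p := f.2.2

/-- The `n`-th derivative as a linear map into the space of continuous functions. -/
def derivMap (n : ℕ) : SmoothPeriodic p →ₗ[ℝ] C(ℝ, ℝ) where
  toFun f := ⟨iteratedDeriv n (f : ℝ → ℝ),
    f.contDiff.continuous_iteratedDeriv n (by exact_mod_cast le_top)⟩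
  map_add' f g := by
    ext t
    exact iteratedDeriv_add (f.contDiff.contDiffAt.of_le (by exact_mod_cast le_top))
      (g.contDiff.contDiffAt.of_le (by exact_mod_cast le_top))
  map_smul' c f := by
    ext t
    exact iteratedDeriv_const_smul_field c (f : ℝ → ℝ)

/-- The usual Fréchet topology of `C^∞(S¹)`: uniform convergence of the derivatives of every order.
(The topology of `C(ℝ, ℝ)` is that of uniform convergence on compact sets, which for functions of
period `p > 0` is uniform convergence.) -/
instance : TopologicalSpace (SmoothPeriodic p) :=
  TopologicalSpace.induced (fun f n => derivMap n f : SmoothPeriodic p → ℕ → C(ℝ, ℝ)) inferInstance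

/-- The derivatives of all orders together, as a linear map. -/
def jetMap : SmoothPeriodic p →ₗ[ℝ] (ℕ → C(ℝ, ℝ)) := LinearMap.pi derivMap

instance : IsTopologicalAddGroup (SmoothPeriodic p) :=
  topologicalAddGroup_induced (jetMap (p := p))

instance : ContinuousSMul ℝ (SmoothPeriodic p) :=
  continuousSMul_induced (jetMap (p := p))

end SmoothPeriodic

/-! ### Smooth maps and submanifolds in topological vector spaces -/

/-- `f` is of class `C^n` on the open set `U`, in the sense of the differential calculus in
topological vector spaces (Michal–Bastiani, Hamilton): `f` is continuous and, if `n ≥ 1`, the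
directional derivatives `df (x, h) = lim_{t → 0} (f (x + t h) - f x) / t` exist for `x ∈ U` and all
`h`, and `df` is of class `C^(n-1)` on `U × E`. -/
def IsClassCOn : ℕ → ∀ {E F : Type} [AddCommGroup E] [Module ℝ E] [TopologicalSpace E]
    [AddCommGroup F] [Module ℝ F] [TopologicalSpace F], (E → F) → Set E → Prop
  | 0, _, _, _, _, _, _, _, _, f, U => ContinuousOn f U
  | n + 1, E, F, _, _, _, _, _, _, f, U => ContinuousOn f U ∧ ∃ df : E × E → F,
      (∀ x ∈ U, ∀ h : E,
        Tendsto (fun t : ℝ => t⁻¹ • (f (x + t • h) - f x)) (𝓝[≠] 0) (𝓝 (df (x, h)))) ∧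
      IsClassCOn n df (U ×ˢ (univ : Set E))

/-- `f` is of class `C^∞` on the open set `U`. -/
def IsSmoothMapOn {E F : Type} [AddCommGroup E] [Module ℝ E] [TopologicalSpace E]
    [AddCommGroup F] [Module ℝ F] [TopologicalSpace F] (f : E → F) (U : Set E) : Prop :=
  ∀ n : ℕ, IsClassCOn n f U

/-- `M` is a (split, embedded) `C^∞` submanifold of `E` modelled on the complemented subspace `F`:
near each of its points there is a `C^∞` diffeomorphism `φ` between open subsets of `E` that
takes `M` to `F`. -/
def IsSubmanifoldModelledOn {E : Type} [AddCommGroup E] [Module ℝ E] [TopologicalSpace E]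
    (M : Set E) (F : Submodule ℝ E) : Prop :=
  F.ClosedComplemented ∧
  ∀ x ∈ M, ∃ φ : OpenPartialHomeomorph E E, x ∈ φ.source ∧
    IsSmoothMapOn φ φ.source ∧ IsSmoothMapOn φ.symm φ.target ∧
    φ '' (φ.source ∩ M) = φ.target ∩ (F : Set E)

/-- `M` is a nonempty `C^∞` submanifold of `E` of infinite dimension. -/
def IsInfiniteDimensionalSubmanifold {E : Type} [AddCommGroup E] [Module ℝ E]
    [TopologicalSpace E] (M : Set E) : Prop :=
  M.Nonempty ∧ ∃ F : Submodule ℝ E, ¬ FiniteDimensional ℝ F ∧ IsSubmanifoldModelledOn M F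

/-! ### The condition on the spectrum and the set of solutions -/

/-- `{λ₁, …, λ_m}` is a subset of `(0, ∞) ∖ {1}`, not of the form `{μ}` or `{μ, μ⁻¹}` with any
`μ > 0`. -/
def SpectrumCondition {m : ℕ} (lam : Fin m → ℝ) : Prop :=
  range lam ⊆ Ioi 0 \ {1} ∧ ∀ μ : ℝ, 0 < μ → range lam ≠ {μ} ∧ range lam ≠ {μ, μ⁻¹}

/-- The set of all `(f, λ₁, …, λ_m)`, with `f` a nonconstant `C^∞` function of period `p` and
`λ₁, …, λ_m > 0`, such that `Ḃ + B² = f + A` and `diag (log λ₁, …, log λ_m) = -∫₀ᵖ B dt` for some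
nonzero traceless diagonal matrix `A` and some `p`-periodic `C^∞` curve `B` of diagonal matrices.
Derivatives and integrals of matrix-valued functions are taken entry by entry. -/
def solutionSet (p : ℝ) (m : ℕ) : Set (SmoothPeriodic p × (Fin m → ℝ)) :=
  {x | (¬ ∃ c : ℝ, ∀ t, x.1 t = c) ∧ (∀ i, 0 < x.2 i) ∧
    ∃ A : Matrix (Fin m) (Fin m) ℝ, A.IsDiag ∧ A ≠ 0 ∧ A.trace = 0 ∧
    ∃ B : ℝ → Matrix (Fin m) (Fin m) ℝ, (∀ t, (B t).IsDiag) ∧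
      (∀ i j, ContDiff ℝ ∞ fun t => B t i j) ∧ Function.Periodic B p ∧
      (∀ t, (Matrix.of fun i j => deriv (fun s => B s i j) t) + B t ^ 2
        = x.1 t • (1 : Matrix (Fin m) (Fin m) ℝ) + A) ∧
      Matrix.diagonal (fun i => Real.log (x.2 i))
        = -(Matrix.of fun i j => ∫ t in (0 : ℝ)..p, B t i j)}

end

/-! For diagonal `B` the equation splits into scalar Riccati equations `bᵢ' + bᵢ² = f + aᵢ`. The
integral condition fixes the mean of `bᵢ` as `cᵢ = -log λᵢ / p ≠ 0`, so `bᵢ = cᵢ + vᵢ` with `vᵢ` of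
mean zero. The oscillation `g = f - mean f` alone determines a small `vᵢ`: `exists_riccati_solution`
solves the mean-zero part of the equation by the inverse function theorem. The mean part then reads
`aᵢ = kᵢ(g) - mean f` with `kᵢ(g) = mean(vᵢ²) + cᵢ²`, and tracelessness amounts to `mean f = σ(g)`,
the average of the `kᵢ(g)`. So `M` is the graph of `σ` over small `g ≠ 0`, a submanifold by
`isInfiniteDimensionalSubmanifold_graph`. At `g = 0` one has `kᵢ = cᵢ²`; the spectrum condition
prevents these from being all equal, whence `A ≠ 0` for small `g`. The analysis takes place in the
Banach space of continuous functions on the circle, through which `σ` factors, so the ordinary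
inverse function theorem suffices; `contDiff_of_riccati` restores smoothness. -/

/-! ### Smooth maps between topological vector spaces -/

/-- A map that is the sum of a continuous linear map and of a vector multiplied by a smooth function
on a normed space, composed with a continuous linear map, is of class `C^n`. -/
theorem isClassCOn_add_smul_comp (n : ℕ) :
    ∀ {E G X : Type} [AddCommGroup E] [Module ℝ E] [TopologicalSpace E]
      [AddCommGroup G] [Module ℝ G] [TopologicalSpace G] [IsTopologicalAddGroup G]
      [ContinuousSMul ℝ G] [NormedAddCommGroup X] [NormedSpace ℝ X]
      (L : E →L[ℝ] G) (ι : E →L[ℝ] X) (e : G) {σ : X → ℝ} {U : Set X},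
      IsOpen U → ContDiffOn ℝ ∞ σ U →
      IsClassCOn n (fun x => L x + σ (ι x) • e) (ι ⁻¹' U) := by
  have cont : ∀ {E G X : Type} [AddCommGroup E] [Module ℝ E] [TopologicalSpace E]
      [AddCommGroup G] [Module ℝ G] [TopologicalSpace G] [IsTopologicalAddGroup G]
      [ContinuousSMul ℝ G] [NormedAddCommGroup X] [NormedSpace ℝ X]
      (L : E →L[ℝ] G) (ι : E →L[ℝ] X) (e : G) {σ : X → ℝ} {U : Set X},
      ContDiffOn ℝ ∞ σ U → ContinuousOn (fun x => L x + σ (ι x) • e) (ι ⁻¹' U) := by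
    intro E G X _ _ _ _ _ _ _ _ _ _ L ι e σ U hσ
    exact L.continuous.continuousOn.add
      ((hσ.continuousOn.comp ι.continuous.continuousOn (mapsTo_preimage _ _)).smul
        continuousOn_const)
  induction n with
  | zero =>
    intro E G X _ _ _ _ _ _ _ _ _ _ L ι e σ U _ hσ
    exact cont L ι e hσ
  | succ n ih =>
    intro E G X _ _ _ _ _ _ _ _ _ _ L ι e σ U hU hσ
    -- The directional derivative has the same shape over `E × E`, with `ι × ι` and the function
    -- `(x, y) ↦ dσ(x) y` on `X × X`, so the induction closes.
    refine ⟨cont L ι e hσ, fun z => L z.2 + fderiv ℝ σ (ι z.1) (ι z.2) • e, ?_, ?_⟩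
    · intro x hx h
      have hd : HasFDerivAt σ (fderiv ℝ σ (ι x)) (ι x) :=
        ((hσ.contDiffAt (hU.mem_nhds hx)).differentiableAt (by simp)).hasFDerivAt
      have h1 := hd.hasLineDerivAt (ι h)
      have h2 := hasDerivAt_iff_tendsto_slope_zero.1 h1
      have h3 := (tendsto_const_nhds (x := L h) (f := 𝓝[≠] (0 : ℝ))).add (h2.smul_const e)
      refine h3.congr' ?_
      filter_upwards [self_mem_nhdsWithin] with t ht
      have ht : t ≠ 0 := ht
      simp only [map_add, map_smul, zero_add, zero_smul, add_zero, smul_eq_mul]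
      rw [show L x + t • L h + σ (ι x + t • ι h) • e - (L x + σ (ι x) • e)
        = t • L h + (σ (ι x + t • ι h) - σ (ι x)) • e by module, smul_add, smul_smul, smul_smul,
        inv_mul_cancel₀ ht, one_smul]
    · have hσ' : ContDiffOn ℝ ∞ (fun z : X × X => fderiv ℝ σ z.1 z.2) (U ×ˢ univ) :=
        ((hσ.fderiv_of_isOpen hU (m := ∞) (by simp)).comp contDiff_fst.contDiffOn
          (fun z hz => hz.1)).clm_apply contDiff_snd.contDiffOn
      exact ih (L.comp (ContinuousLinearMap.snd ℝ E E)) (ι.prodMap ι) e (hU.prod isOpen_univ) hσ'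

/-! ### Continuous functions on the circle -/

section Circle

theorem continuous_coe_circle {p : ℝ} (h : C(AddCircle p, ℝ)) : Continuous fun t : ℝ => h t :=
  h.continuous.comp (AddCircle.continuous_mk' p)

variable {p : ℝ} [hp : Fact (0 < p)]

/-- The integral of a continuous function on the circle against a continuous kernel. -/
noncomputable def kernelOp (k : C(ℝ, ℝ)) : C(AddCircle p, ℝ) →L[ℝ] C(AddCircle p, ℝ) :=
  LinearMap.mkContinuousOfExistsBound
    { toFun := fun h => ⟨fun x => ∫ s in (0 : ℝ)..p, k s * h (x + (s : AddCircle p)), by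
        apply intervalIntegral.continuous_parametric_intervalIntegral_of_continuous'
        have := AddCircle.continuous_mk' p
        fun_prop⟩
      map_add' := fun h₁ h₂ => by
        have := AddCircle.continuous_mk' p
        ext x
        simp only [ContinuousMap.add_apply, ContinuousMap.coe_mk, mul_add]
        apply intervalIntegral.integral_add <;> apply Continuous.intervalIntegrable <;> fun_prop
      map_smul' := fun c h => by
        ext x
        simp only [ContinuousMap.smul_apply, ContinuousMap.coe_mk, smul_eq_mul, RingHom.id_apply,
          mul_left_comm _ c]
        exact intervalIntegral.integral_const_mul _ _ }
    (by
      obtain ⟨C, hC⟩ := (isCompact_uIcc (a := (0 : ℝ)) (b := p)).exists_bound_of_continuousOn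
        k.continuous.continuousOn
      have hC0 : 0 ≤ C := (norm_nonneg _).trans (hC 0 left_mem_uIcc)
      refine ⟨C * p, fun h => (ContinuousMap.norm_le _ (by have := hp.out; positivity)).2 fun x => ?_⟩
      refine (intervalIntegral.norm_integral_le_of_norm_le_const (C := C * ‖h‖)
        fun s hs => ?_).trans_eq ?_
      · rw [norm_mul]
        exact mul_le_mul (hC s (uIoc_subset_uIcc hs)) (h.norm_coe_le_norm _) (norm_nonneg _) hC0
      · rw [sub_zero, abs_of_pos hp.out]; ring)

theorem kernelOp_apply (k : C(ℝ, ℝ)) (h : C(AddCircle p, ℝ)) (x : AddCircle p) :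
    kernelOp k h x = ∫ s in (0 : ℝ)..p, k s * h (x + (s : AddCircle p)) := rfl

/-- The mean value of a continuous function on the circle. -/
noncomputable def circleMean (p : ℝ) [Fact (0 < p)] : C(AddCircle p, ℝ) →L[ℝ] ℝ :=
  p⁻¹ • (ContinuousMap.evalCLM ℝ (0 : AddCircle p)).comp (kernelOp 1)

theorem circleMean_apply (h : C(AddCircle p, ℝ)) :
    circleMean p h = p⁻¹ * ∫ s in (0 : ℝ)..p, h (s : AddCircle p) := by
  simp [circleMean, kernelOp_apply]

@[simp] theorem circleMean_one : circleMean p 1 = 1 := by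
  simp [circleMean_apply, hp.out.ne']

/-- The projection of continuous functions on the circle onto those of mean zero. -/
noncomputable def circleProj (p : ℝ) [Fact (0 < p)] :
    C(AddCircle p, ℝ) →L[ℝ] C(AddCircle p, ℝ) :=
  ContinuousLinearMap.id ℝ _ - (circleMean p).smulRight 1

theorem circleProj_apply (h : C(AddCircle p, ℝ)) : circleProj p h = h - circleMean p h • 1 := rfl

@[simp] theorem circleMean_circleProj (h : C(AddCircle p, ℝ)) :
    circleMean p (circleProj p h) = 0 := by
  simp [circleProj_apply]

/-! ### Periodic solutions of linear and Riccati equations. -/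

/-- For `κ ≠ 0`, the equation `v' + κ v = h` on the circle has a solution depending linearly and
continuously on `h`. -/
theorem exists_periodic_solution_operator {κ : ℝ} (hκ : κ ≠ 0) :
    ∃ T : C(AddCircle p, ℝ) →L[ℝ] C(AddCircle p, ℝ), ∀ (h : C(AddCircle p, ℝ)) (t : ℝ),
      HasDerivAt (fun t : ℝ => T h t) (h t - κ * T h t) t := by
  have hD : Real.exp (κ * p) - 1 ≠ 0 := by
    rw [sub_ne_zero, Ne, Real.exp_eq_one_iff]
    exact mul_ne_zero hκ hp.out.ne'
  set D := Real.exp (κ * p) - 1 with hDdef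
  -- Variation of constants: `e^(κt) v` has derivative `e^(κt) h`, and periodicity of `v` turns its
  -- increment over one period into `D e^(κt) v(t)`.
  refine ⟨D⁻¹ • kernelOp ⟨fun s => Real.exp (κ * s), by fun_prop⟩, fun h t => ?_⟩
  set F : ℝ → ℝ := fun u => Real.exp (κ * u) * h u with hF
  have hFc : Continuous F := by
    have := continuous_coe_circle h
    fun_prop
  have key : ∀ t : ℝ, (D⁻¹ • kernelOp ⟨fun s => Real.exp (κ * s), by fun_prop⟩) h (t : AddCircle p)
      = D⁻¹ * (Real.exp (-(κ * t)) * ((∫ u in (0 : ℝ)..(t + p), F u) - ∫ u in (0 : ℝ)..t, F u)) := by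
    intro t
    rw [intervalIntegral.integral_interval_sub_left (hFc.intervalIntegrable _ _)
      (hFc.intervalIntegrable _ _), smul_apply, ContinuousMap.smul_apply,
      kernelOp_apply, smul_eq_mul]
    congr 1
    have := intervalIntegral.integral_comp_add_right (a := 0) (b := p) F t
    rw [zero_add, add_comm p t] at this
    rw [← this, ← intervalIntegral.integral_const_mul]
    refine intervalIntegral.integral_congr fun s _ => ?_
    simp only [hF, ContinuousMap.coe_mk, AddCircle.coe_add]
    rw [← mul_assoc, ← Real.exp_add, add_comm (s : AddCircle p)]
    congr 2
    ring
  rw [key t]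
  have h1 : HasDerivAt (fun t : ℝ => ∫ u in (0 : ℝ)..t, F u) (F t) t :=
    intervalIntegral.integral_hasDerivAt_right (hFc.intervalIntegrable _ _)
      (hFc.stronglyMeasurableAtFilter _ _) hFc.continuousAt
  have h2 : HasDerivAt (fun t : ℝ => ∫ u in (0 : ℝ)..(t + p), F u) (F (t + p)) t :=
    (intervalIntegral.integral_hasDerivAt_right (hFc.intervalIntegrable _ _)
      (hFc.stronglyMeasurableAtFilter _ _) hFc.continuousAt).comp_add_const t p
  have h3 : HasDerivAt (fun t : ℝ => Real.exp (-(κ * t))) (Real.exp (-(κ * t)) * -(κ * 1)) t :=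
    (((hasDerivAt_id t).const_mul κ).neg).exp
  rw [funext key]
  refine ((h3.mul (h2.sub h1)).const_mul D⁻¹).congr_deriv ?_
  have e1 : F (t + p) = Real.exp (κ * t) * (D + 1) * h t := by
    simp only [hF, hDdef, sub_add_cancel, ← Real.exp_add, AddCircle.coe_add_period, mul_add]
  have e2 : Real.exp (-(κ * t)) * Real.exp (κ * t) = 1 := by
    rw [← Real.exp_add]; simp
  have e3 : F t = Real.exp (κ * t) * h t := rfl
  rw [Pi.sub_apply, e1, e3]
  set I := (∫ u in (0 : ℝ)..(t + p), F u) - ∫ u in (0 : ℝ)..t, F u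
  field_simp
  linear_combination D * h t * e2

/-- If `v' = q - κ v` on the circle with `κ ≠ 0`, and `q` has mean zero, then so has `v`. -/
theorem circleMean_eq_zero_of_hasDerivAt {κ : ℝ} (hκ : κ ≠ 0) {q v : C(AddCircle p, ℝ)}
    (hv : ∀ t : ℝ, HasDerivAt (fun t : ℝ => v t) (q t - κ * v t) t) (hq : circleMean p q = 0) :
    circleMean p v = 0 := by
  have hqc := continuous_coe_circle q
  have hvc := continuous_coe_circle v
  -- Over a period the integral of `v'` vanishes, leaving `0 = ∫ q - κ ∫ v`.
  have h1 := intervalIntegral.integral_eq_sub_of_hasDerivAt (a := 0) (b := p) (fun t _ => hv t)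
    (Continuous.intervalIntegrable (by fun_prop) _ _)
  rw [intervalIntegral.integral_sub (hqc.intervalIntegrable _ _)
    (Continuous.intervalIntegrable (by fun_prop) _ _), intervalIntegral.integral_const_mul] at h1
  have h2 : (v ((p : ℝ) : AddCircle p)) = v ((0 : ℝ) : AddCircle p) := by
    rw [AddCircle.coe_period]; rfl
  rw [h2, sub_self] at h1
  rw [circleMean_apply] at hq ⊢
  have hp' := inv_ne_zero hp.out.ne'
  have h3 := (mul_eq_zero.1 hq).resolve_left hp'
  rw [h3, zero_sub, neg_eq_zero] at h1
  rw [(mul_eq_zero.1 h1).resolve_left hκ, mul_zero]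

/-- For `c ≠ 0`, the equation `v' + 2 c v + v ^ 2 = g + const` on the circle has, for small `g`, a
solution `v` of mean zero that depends analytically on `g`. -/
theorem exists_riccati_solution {c : ℝ} (hc : c ≠ 0) :
    ∃ v : C(AddCircle p, ℝ) → C(AddCircle p, ℝ), ContDiffAt ℝ ω v 0 ∧ v 0 = 0 ∧
      ∀ᶠ g in 𝓝 (0 : C(AddCircle p, ℝ)), circleMean p (v g) = 0 ∧ ∀ t : ℝ,
        HasDerivAt (fun t : ℝ => v g t) (circleProj p (g - v g * v g) t - 2 * c * v g t) t := by
  obtain ⟨T, hT⟩ := exists_periodic_solution_operator (p := p) (κ := 2 * c) (by simpa using hc)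
  set S := T.comp (circleProj p) with hS
  -- A solution is a fixed point `v = S (g - v²)`, that is, `Ψ v = S g`. The projection inside `S`
  -- absorbs the unknown constant, and `Ψ` has derivative `id` at `0` because `v²` is quadratic.
  set Ψ : C(AddCircle p, ℝ) → C(AddCircle p, ℝ) := fun v => v + S (v * v) with hΨ
  have hΨs : ContDiffAt ℝ ω Ψ 0 :=
    (contDiff_id.add (S.contDiff.comp (contDiff_id.mul contDiff_id))).contDiffAt
  have hΨ' : HasFDerivAt Ψ
      ((ContinuousLinearEquiv.refl ℝ C(AddCircle p, ℝ) : _ →L[ℝ] C(AddCircle p, ℝ))) 0 := by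
    have h1 : HasFDerivAt Ψ _ 0 := (hasFDerivAt_id (0 : C(AddCircle p, ℝ))).add
      (S.hasFDerivAt.comp (0 : C(AddCircle p, ℝ))
        ((hasFDerivAt_id (0 : C(AddCircle p, ℝ))).mul' (hasFDerivAt_id 0)))
    refine h1.congr_fderiv ?_
    ext u x
    simp
  have hn : (ω : WithTop ℕ∞) ≠ 0 := by simp
  have hΨ0 : Ψ 0 = 0 := by simp [hΨ]
  set w := hΨs.localInverse hΨ' hn with hw
  have hw0 : w 0 = 0 := by
    have := hΨs.localInverse_apply_image hΨ' hn
    rwa [hΨ0] at this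
  have hws : ContDiffAt ℝ ω w 0 := by
    have := hΨs.to_localInverse hΨ' hn
    rwa [hΨ0] at this
  have hinv : ∀ᶠ y in 𝓝 (0 : C(AddCircle p, ℝ)), Ψ (w y) = y := by
    have := (hΨs.hasStrictFDerivAt' hΨ' hn).eventually_right_inverse
    rwa [hΨ0] at this
  have hS0 : S 0 = 0 := map_zero S
  refine ⟨fun g => w (S g), ?_, by simp [hw0], ?_⟩
  · exact ContDiffAt.comp (0 : C(AddCircle p, ℝ)) (by rwa [hS0]) S.contDiff.contDiffAt
  · have hSt : Tendsto S (𝓝 0) (𝓝 0) := by simpa using S.continuous.tendsto 0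
    filter_upwards [hSt.eventually hinv] with g hg
    have hg' : w (S g) = T (circleProj p (g - w (S g) * w (S g))) := by
      rw [show T (circleProj p (g - w (S g) * w (S g))) = S (g - w (S g) * w (S g)) from rfl,
        map_sub, eq_sub_iff_add_eq]
      exact hg
    have hd : ∀ t : ℝ, HasDerivAt (fun t : ℝ => w (S g) t)
        (circleProj p (g - w (S g) * w (S g)) t - 2 * c * w (S g) t) t := by
      intro t
      have := hT (circleProj p (g - w (S g) * w (S g))) t
      rwa [← hg'] at this
    exact ⟨circleMean_eq_zero_of_hasDerivAt (by simpa using hc) hd (circleMean_circleProj _), hd⟩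

end Circle

/-- A differentiable solution of a Riccati equation with smooth coefficients is smooth. -/
theorem contDiff_of_riccati {q v : ℝ → ℝ} {κ : ℝ} (hq : ContDiff ℝ ∞ q)
    (hv : ∀ t, HasDerivAt v (q t - κ * v t - v t * v t) t) : ContDiff ℝ ∞ v := by
  have hd : deriv v = fun t => q t - κ * v t - v t * v t := funext fun t => (hv t).deriv
  rw [contDiff_infty]
  intro n
  induction n with
  | zero => exact contDiff_zero.2 (continuous_iff_continuousAt.2 fun t => (hv t).continuousAt)
  | succ n ih =>
    -- Bootstrapping: the equation expresses `v'` as a polynomial in `q` and `v`, so `C^n` improves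
    -- to `C^(n+1)`.
    rw [Nat.cast_add, Nat.cast_one, contDiff_succ_iff_deriv]
    refine ⟨fun t => (hv t).differentiableAt, by simp, ?_⟩
    rw [hd]
    exact ((contDiff_infty.1 hq n).sub (contDiff_const.mul ih)).sub (ih.mul ih)

/-! ### Mean, oscillation and graphs in the Fréchet space. -/

namespace SmoothPeriodic

variable {p : ℝ}

@[ext] theorem ext {f g : SmoothPeriodic p} (h : ∀ t, f t = g t) : f = g :=
  Subtype.ext (funext h)

@[simp] theorem smul_apply (c : ℝ) (f : SmoothPeriodic p) (t : ℝ) : (c • f) t = c * f t := rfl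

/-- The constant function `1`. -/
def one : SmoothPeriodic p := ⟨fun _ => 1, contDiff_const, fun _ => rfl⟩

@[simp] theorem one_apply (t : ℝ) : (one : SmoothPeriodic p) t = 1 := rfl

theorem continuous_derivMap (n : ℕ) : Continuous (derivMap n : SmoothPeriodic p → C(ℝ, ℝ)) :=
  (continuous_apply n).comp
    (continuous_induced_dom (f := fun (f : SmoothPeriodic p) m => derivMap m f))

variable [hp : Fact (0 < p)]

/-- A smooth periodic function as a continuous function on the circle. -/
def toCircleLinear (p : ℝ) : SmoothPeriodic p →ₗ[ℝ] C(AddCircle p, ℝ) where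
  toFun f := ⟨f.periodic.lift, continuous_quot_lift _ f.contDiff.continuous⟩
  map_add' f g := by
    ext x
    induction x using QuotientAddGroup.induction_on
    rfl
  map_smul' c f := by
    ext x
    induction x using QuotientAddGroup.induction_on
    rfl

/-- The continuous inclusion of the smooth periodic functions in the continuous functions on the
circle. -/
noncomputable def toCircle (p : ℝ) [hp : Fact (0 < p)] :
    SmoothPeriodic p →L[ℝ] C(AddCircle p, ℝ) where
  toLinearMap := toCircleLinear p
  cont := by
    refine continuous_of_continuousAt_zero (toCircleLinear p) ?_
    -- By periodicity the norm on the circle is bounded by the supremum over `[0, p]`, a continuous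
    -- seminorm.
    have hr : Continuous fun f : SmoothPeriodic p => ‖(derivMap 0 f).restrict (Icc 0 p)‖ :=
      ((ContinuousMap.continuous_restrict _).comp (continuous_derivMap 0)).norm
    have h0 := hr.tendsto 0
    simp only [map_zero] at h0
    rw [ContinuousAt, map_zero]
    refine squeeze_zero_norm (fun f => ?_) (h0.trans_eq ?_)
    · refine (ContinuousMap.norm_le _ (norm_nonneg _)).2 fun x => ?_
      obtain ⟨t, ht, rfl⟩ : ∃ t ∈ Icc (0 : ℝ) p, (t : AddCircle p) = x := by
        have := AddCircle.coe_image_Icc_eq p 0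
        rw [zero_add] at this
        exact this.ge (mem_univ x)
      have h1 := ((derivMap 0 f).restrict (Icc 0 p)).norm_coe_le_norm ⟨t, ht⟩
      change ‖iteratedDeriv 0 (f : ℝ → ℝ) t‖ ≤ _ at h1
      rwa [iteratedDeriv_zero] at h1
    · congr 1
      exact norm_zero

@[simp] theorem toCircle_apply (f : SmoothPeriodic p) (t : ℝ) :
    toCircle p f (t : AddCircle p) = f t := rfl

@[simp] theorem toCircle_one : toCircle p one = 1 := by
  ext x
  induction x using QuotientAddGroup.induction_on
  rfl

theorem toCircle_injective : Function.Injective (toCircle p) := fun f g h => by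
  ext t
  rw [← toCircle_apply, h, toCircle_apply]

/-- The mean value of a smooth periodic function. -/
noncomputable def mean (p : ℝ) [hp : Fact (0 < p)] : SmoothPeriodic p →L[ℝ] ℝ :=
  (circleMean p).comp (toCircle p)

@[simp] theorem mean_one : mean p one = 1 := by simp [mean]

/-- Polynomials in a sine of period `p` form an infinite-dimensional subspace: one that vanishes
identically has every point of `[-1, 1]` as a root. -/
theorem not_finiteDimensional : ¬ FiniteDimensional ℝ (SmoothPeriodic p) := by
  intro hfin
  set s : ℝ → ℝ := fun t => Real.sin (t * (2 * Real.pi / p)) with hs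
  have hsc : ContDiff ℝ ∞ s := Real.contDiff_sin.comp (contDiff_id.mul contDiff_const)
  have hsp : Function.Periodic s p := fun t => by
    have : (t + p) * (2 * Real.pi / p) = t * (2 * Real.pi / p) + 2 * Real.pi := by
      have := hp.out.ne'
      field_simp
    simp only [hs, this, Real.sin_add_two_pi]
  let Λ : Polynomial ℝ →ₗ[ℝ] SmoothPeriodic p :=
    { toFun := fun q => ⟨fun t => q.eval (s t), by
          simpa [Function.comp_def] using (Polynomial.contDiff_aeval q ∞).comp hsc,
        fun t => by simp only [hsp t]⟩
      map_add' := fun q r => by ext t; exact Polynomial.eval_add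
      map_smul' := fun c q => by ext t; exact Polynomial.eval_smul c q (s t) }
  refine Polynomial.not_finite (R := ℝ) (FiniteDimensional.of_injective Λ ?_)
  refine (injective_iff_map_eq_zero Λ).2 fun q hq => ?_
  refine Polynomial.eq_zero_of_infinite_isRoot q
    ((Icc_infinite (show (-1 : ℝ) < 1 by norm_num)).mono ?_)
  intro y hy
  have h1 : Λ q (Real.arcsin y / (2 * Real.pi / p)) = 0 := by rw [hq]; rfl
  have h2 : s (Real.arcsin y / (2 * Real.pi / p)) = y := by
    have := hp.out.ne'
    have := Real.pi_ne_zero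
    simp only [hs]
    rw [div_mul_cancel₀ _ (by positivity), Real.sin_arcsin hy.1 hy.2]
  change q.eval _ = 0
  rw [← h2]
  exact h1

theorem not_finiteDimensional_ker_mean : ¬ FiniteDimensional ℝ (mean p).ker := by
  intro h
  have : Module.Finite ℝ (SmoothPeriodic p ⧸ (mean p).ker) :=
    Module.Finite.equiv (LinearMap.quotKerEquivRange (mean p : SmoothPeriodic p →ₗ[ℝ] ℝ)).symm
  exact not_finiteDimensional (Module.Finite.of_submodule_quotient (mean p).ker)

/-- The part of mean zero of a smooth periodic function, as a continuous function. -/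
noncomputable def oscillation (p : ℝ) [hp : Fact (0 < p)] :
    SmoothPeriodic p →L[ℝ] C(AddCircle p, ℝ) :=
  (circleProj p).comp (toCircle p)

theorem oscillation_apply (f : SmoothPeriodic p) :
    oscillation p f = toCircle p f - mean p f • 1 := rfl

theorem oscillation_coe (f : SmoothPeriodic p) (t : ℝ) :
    oscillation p f (t : AddCircle p) = f t - mean p f := by
  simp [oscillation_apply]

@[simp] theorem oscillation_one : oscillation p one = 0 := by
  simp [oscillation_apply]

theorem oscillation_eq_zero_of_const {f : SmoothPeriodic p} {c : ℝ} (h : ∀ t, f t = c) :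
    oscillation p f = 0 := by
  rw [show f = c • one by ext t; simp [h], map_smul, oscillation_one, smul_zero]

/-- The graph of a smooth function over an open set of nonconstant functions of mean zero is a
submanifold. -/
theorem isInfiniteDimensionalSubmanifold_graph {U : Set C(AddCircle p, ℝ)} (hU : IsOpen U)
    (h0 : 0 ∈ U) {σ : C(AddCircle p, ℝ) → ℝ} (hσ : ContDiffOn ℝ ∞ σ U) :
    IsInfiniteDimensionalSubmanifold
      {f : SmoothPeriodic p | oscillation p f ∈ U \ {0} ∧ mean p f = σ (oscillation p f)} := by
  set V : Set C(AddCircle p, ℝ) := U \ {0} with hV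
  have hVo : IsOpen V := hU.sdiff isClosed_singleton
  have hσV : ContDiffOn ℝ ∞ σ V := hσ.mono sdiff_subset
  have hosc : ∀ (f : SmoothPeriodic p) (r : ℝ), oscillation p (f + r • one) = oscillation p f := by
    intro f r
    rw [map_add, map_smul, oscillation_one, smul_zero, add_zero]
  have hmean : ∀ (f : SmoothPeriodic p) (r : ℝ), mean p (f + r • one) = mean p f + r := by
    intro f r
    rw [map_add, map_smul, mean_one, smul_eq_mul, mul_one]
  refine ⟨?_, (mean p).ker, not_finiteDimensional_ker_mean, ?_, ?_⟩
  · have hnt : Nontrivial (mean p).ker := by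
      by_contra hn
      rw [not_nontrivial_iff_subsingleton] at hn
      exact not_finiteDimensional_ker_mean (p := p) inferInstance
    obtain ⟨⟨g, hg⟩, hg0⟩ := exists_ne (0 : (mean p).ker)
    have hg : mean p g = 0 := hg
    have hgo : oscillation p g ≠ 0 := by
      rw [oscillation_apply, hg, zero_smul, sub_zero]
      exact fun h => hg0 (Subtype.ext (toCircle_injective (h.trans (map_zero _).symm)))
    have ht : Tendsto (fun ε : ℝ => ε • oscillation p g) (𝓝[≠] 0) (𝓝 0) := by
      have : Continuous fun ε : ℝ => ε • oscillation p g := by fun_prop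
      simpa using (this.tendsto 0).mono_left nhdsWithin_le_nhds
    obtain ⟨ε, hε, hε0⟩ := ((ht.eventually (hU.mem_nhds h0)).and self_mem_nhdsWithin).exists
    have hε0 : ε ≠ 0 := hε0
    -- The point of the graph above the small nonzero oscillation of `ε • g`.
    refine ⟨ε • g + σ (ε • oscillation p g) • one, ?_, ?_⟩
    · rw [hosc, map_smul]
      exact ⟨hε, smul_ne_zero hε0 hgo⟩
    · rw [hosc, hmean, map_smul, map_smul, hg, smul_zero, zero_add]
  · let Q : SmoothPeriodic p →L[ℝ] SmoothPeriodic p :=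
      ContinuousLinearMap.id ℝ (SmoothPeriodic p) - (mean p).smulRight one
    have hQ : ∀ f, Q f = f - mean p f • one := fun f => rfl
    have hker : ∀ f, Q f ∈ (mean p).ker := fun f => show mean p (Q f) = 0 by simp [hQ]
    refine ⟨Q.codRestrict _ hker, fun f => ?_⟩
    have hf : mean p (f : SmoothPeriodic p) = 0 := f.2
    refine Subtype.ext ((hQ f).trans ?_)
    rw [hf, zero_smul, sub_zero]
  · intro f hf
    have hcl : ∀ e : SmoothPeriodic p, ∀ n,
        IsClassCOn n (fun f : SmoothPeriodic p => f + σ (oscillation p f) • e)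
          (oscillation p ⁻¹' V) := fun e n =>
      isClassCOn_add_smul_comp n (ContinuousLinearMap.id ℝ _) (oscillation p) e hVo hσV
    have hsub : (fun f : SmoothPeriodic p => f + (-σ (oscillation p f)) • one)
        = fun f => f + σ (oscillation p f) • (-one) := by
      funext f
      rw [neg_smul, smul_neg]
    have hcont : ∀ {g : SmoothPeriodic p → SmoothPeriodic p} {W}, IsClassCOn 0 g W →
      ContinuousOn g W := fun h => h
    -- A shear along the constants: it preserves the oscillation, hence is inverted by changing the
    -- sign of `σ`, and it lowers the mean by `σ`, flattening the graph onto the kernel of `mean`.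
    let φ : OpenPartialHomeomorph (SmoothPeriodic p) (SmoothPeriodic p) :=
      { toFun := fun f => f + (-σ (oscillation p f)) • one
        invFun := fun f => f + σ (oscillation p f) • one
        source := oscillation p ⁻¹' V
        target := oscillation p ⁻¹' V
        map_source' := fun f hf => by rwa [mem_preimage, hosc]
        map_target' := fun f hf => by rwa [mem_preimage, hosc]
        left_inv' := fun f _ => by rw [hosc, neg_smul, neg_add_cancel_right]
        right_inv' := fun f _ => by rw [hosc, neg_smul, add_neg_cancel_right]
        open_source := hVo.preimage (oscillation p).continuous
        open_target := hVo.preimage (oscillation p).continuous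
        continuousOn_toFun := by
          rw [hsub]
          exact hcont (hcl (-one) 0)
        continuousOn_invFun := hcont (hcl one 0) }
    refine ⟨φ, hf.1, fun n => ?_, hcl one, ?_⟩
    · change IsClassCOn n (fun f : SmoothPeriodic p => f + (-σ (oscillation p f)) • one) _
      rw [hsub]
      exact hcl (-one) n
    · ext g
      constructor
      · rintro ⟨f, ⟨hf1, -, hf2⟩, rfl⟩
        refine ⟨φ.map_source hf1, ?_⟩
        change mean p (f + (-σ (oscillation p f)) • one) = 0
        rw [hmean, hf2, add_neg_cancel]
      · rintro ⟨hg1, hg2⟩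
        have hg2 : mean p g = 0 := hg2
        refine ⟨φ.symm g, ⟨φ.map_target hg1, φ.map_target hg1, ?_⟩, φ.right_inv hg1⟩
        change mean p (g + σ (oscillation p g) • one) = σ (oscillation p (g + _ • one))
        rw [hosc, hmean, hg2, zero_add]

end SmoothPeriodic

/-! ### The spectrum condition and the construction of `M`. -/

/-- Under the spectrum condition, the numbers `(log λᵢ) ^ 2` are not all equal to a given number. -/
theorem SpectrumCondition.exists_sq_log_ne {m : ℕ} {lam : Fin m → ℝ} (hlam : SpectrumCondition lam)
    (i₀ : Fin m) (r : ℝ) : ∃ i, Real.log (lam i) ^ 2 ≠ r := by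
  by_contra! hr
  have hpos : ∀ i, 0 < lam i := fun i => (hlam.1 (mem_range_self i)).1
  have hor : ∀ i, lam i = lam i₀ ∨ lam i = (lam i₀)⁻¹ := by
    intro i
    rcases sq_eq_sq_iff_eq_or_eq_neg.1 ((hr i).trans (hr i₀).symm) with h | h
    · exact Or.inl (Real.log_injOn_pos (hpos i) (hpos i₀) h)
    · rw [← Real.log_inv] at h
      exact Or.inr (Real.log_injOn_pos (hpos i) (inv_pos.2 (hpos i₀)) h)
  obtain ⟨h1, h2⟩ := hlam.2 (lam i₀) (hpos i₀)
  by_cases hex : ∃ j, lam j = (lam i₀)⁻¹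
  · obtain ⟨j, hj⟩ := hex
    refine h2 (Subset.antisymm ?_ ?_)
    · rintro _ ⟨i, rfl⟩
      exact hor i
    · rintro _ (rfl | rfl)
      · exact mem_range_self i₀
      · exact ⟨j, hj⟩
  · refine h1 (Subset.antisymm ?_ ?_)
    · rintro _ ⟨i, rfl⟩
      exact (hor i).resolve_right fun h => hex ⟨i, h⟩
    · rintro _ rfl
      exact mem_range_self i₀

/-- A diagonal system of scalar Riccati equations yields an element of the solution set. -/
theorem mem_solutionSet_of_riccati {p : ℝ} {m : ℕ} {f : SmoothPeriodic p} {lam a : Fin m → ℝ}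
    {b : Fin m → ℝ → ℝ} (hf : ¬ ∃ c : ℝ, ∀ t, f t = c) (hpos : ∀ i, 0 < lam i)
    (ha : ∃ i, a i ≠ 0) (ha' : ∑ i, a i = 0) (hb : ∀ i, ContDiff ℝ ∞ (b i))
    (hbp : ∀ i, Function.Periodic (b i) p) (hode : ∀ i t, deriv (b i) t + b i t ^ 2 = f t + a i)
    (hint : ∀ i, Real.log (lam i) = -∫ t in (0 : ℝ)..p, b i t) : (f, lam) ∈ solutionSet p m := by
  refine ⟨hf, hpos, Matrix.diagonal a, Matrix.isDiag_diagonal a, ?_, by simpa using ha',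
    fun t => Matrix.diagonal fun i => b i t, fun t => Matrix.isDiag_diagonal _, ?_, ?_, ?_, ?_⟩
  · obtain ⟨i, hi⟩ := ha
    exact fun h => hi (by simpa using congrFun (congrFun h i) i)
  · intro i j
    rcases eq_or_ne i j with rfl | hij
    · simpa using hb i
    · simpa [hij] using contDiff_const
  · intro t
    simp only [hbp _ t]
  · intro t
    ext i j
    rcases eq_or_ne i j with rfl | hij
    · simpa [Matrix.diagonal_pow] using hode i t
    · simp [Matrix.diagonal_pow, hij]
  · ext i j
    rcases eq_or_ne i j with rfl | hij
    · simpa using hint i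
    · simp [hij]

theorem theorem6p2 (p : ℝ) (hp : 0 < p) (m : ℕ) (hm : 3 ≤ m) (lam : Fin m → ℝ)
    (hlam : SpectrumCondition lam) :
    ∃ M : Set (SmoothPeriodic p), IsInfiniteDimensionalSubmanifold M ∧
      ∀ f ∈ M, (f, lam) ∈ solutionSet p m := by
  have : Fact (0 < p) := ⟨hp⟩
  have hm0 : (m : ℝ) ≠ 0 := by positivity
  have hpos : ∀ i, 0 < lam i := fun i => (hlam.1 (mem_range_self i)).1
  set c : Fin m → ℝ := fun i => -Real.log (lam i) / p with hc
  have hc0 : ∀ i, c i ≠ 0 := fun i => div_ne_zero (neg_ne_zero.2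
    (Real.log_ne_zero_of_pos_of_ne_one (hpos i) (hlam.1 (mem_range_self i)).2)) hp.ne'
  choose v hvs hv0 hv using fun i => exists_riccati_solution (p := p) (hc0 i)
  set k : Fin m → C(AddCircle p, ℝ) → ℝ := fun i g => circleMean p (v i g * v i g) + c i ^ 2 with hk
  set σ : C(AddCircle p, ℝ) → ℝ := fun g => (m : ℝ)⁻¹ * ∑ i, k i g with hσ
  have hks : ∀ i, ContDiffAt ℝ ω (k i) 0 := fun i =>
    ((circleMean p).contDiff.contDiffAt.comp _ ((hvs i).mul (hvs i))).add contDiffAt_const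
  have hσs : ContDiffAt ℝ ω σ 0 :=
    contDiffAt_const.mul (ContDiffAt.sum fun i _ => hks i)
  obtain ⟨i₁, hi₁⟩ : ∃ i, k i 0 - σ 0 ≠ 0 := by
    -- Since `v i 0 = 0`, the value `k i 0` is `(log λᵢ)² / p²`; hence the factor `p ^ 2`.
    obtain ⟨i, hi⟩ := hlam.exists_sq_log_ne ⟨0, by omega⟩ (σ 0 * p ^ 2)
    refine ⟨i, fun h => hi ?_⟩
    rw [← sub_eq_zero.1 h]
    simp only [hk, hv0, hc]
    field_simp
    simp
  have hne : ∀ᶠ g in 𝓝 0, k i₁ g - σ g ≠ 0 :=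
    ((hks i₁).continuousAt.sub hσs.continuousAt).eventually_ne hi₁
  -- Regularity `ω` at a point persists on a neighbourhood, whereas `∞` at a point only gives, for
  -- each finite order, a neighbourhood depending on that order.
  obtain ⟨U, hUsub, hUo, h0U⟩ := mem_nhds_iff.1
    ((hσs.eventually (by simp)).and (hne.and (eventually_all.2 hv)))
  refine ⟨_, SmoothPeriodic.isInfiniteDimensionalSubmanifold_graph hUo h0U (σ := σ)
    fun g hg => ((hUsub hg).1.of_le le_top).contDiffWithinAt, ?_⟩
  rintro f ⟨⟨hfU, hf0⟩, hfσ⟩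
  set g := SmoothPeriodic.oscillation p f with hg
  obtain ⟨-, hne, hv⟩ := hUsub hfU
  have hgm : circleMean p g = 0 := circleMean_circleProj _
  have hode : ∀ i t, HasDerivAt (fun t : ℝ => v i g t)
      (f t + (k i g - σ g - c i ^ 2) - 2 * c i * v i g t - v i g t * v i g t) t := by
    intro i t
    -- The constant removed by the projection is `-mean(vᵢ²) = cᵢ² - kᵢ(g)`, and `g = f - σ(g)` on
    -- the graph.
    refine ((hv i).2 t).congr_deriv ?_
    rw [circleProj_apply, map_sub, hgm]
    simp only [ContinuousMap.sub_apply, ContinuousMap.mul_apply, ContinuousMap.smul_apply,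
      ContinuousMap.one_apply, hk, hg, SmoothPeriodic.oscillation_coe, hfσ, smul_eq_mul]
    ring
  have hsmooth : ∀ i, ContDiff ℝ ∞ fun t : ℝ => v i g t := fun i =>
    contDiff_of_riccati (f.contDiff.add contDiff_const) (hode i)
  refine mem_solutionSet_of_riccati (a := fun i => k i g - σ g) (b := fun i t => c i + v i g t)
    ?_ hpos ⟨i₁, hne⟩ ?_ (fun i => contDiff_const.add (hsmooth i)) ?_ ?_ ?_
  · rintro ⟨r, hr⟩
    exact hf0 (SmoothPeriodic.oscillation_eq_zero_of_const hr)
  · rw [Finset.sum_sub_distrib, Finset.sum_const, Finset.card_univ, Fintype.card_fin, nsmul_eq_mul]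
    simp only [hσ]
    rw [mul_inv_cancel_left₀ hm0, sub_self]
  · intro i t
    simp only [AddCircle.coe_add_period]
  · intro i t
    rw [((hode i t).const_add (c i)).deriv]
    ring
  · intro i
    have hm := (hv i).1
    rw [circleMean_apply] at hm
    have hI := (mul_eq_zero.1 hm).resolve_left (inv_ne_zero hp.ne')
    rw [intervalIntegral.integral_add (by simp)
      ((continuous_coe_circle (v i g)).intervalIntegrable _ _), hI]
    simp only [hc, intervalIntegral.integral_const, smul_eq_mul]
    field_simp
    ring
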